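/- \textbf{Theorem (existence of SOV representations).} Let $\mathsf N$ be a number of sites, let $q\in\mathbb C\setminus\{0\}$ with $q^2\neq 1$, and let $\eta_1,\dots,\eta_{\mathsf N}\in\mathbb C\setminus\{0\}$. On $\mathcal R_{\mathsf N}=(\mathbb C^2)^{\otimes \mathsf N}$ let $\sigma_n^z,\sigma_n^{\pm}$ be the Pauli matrices $\sigma^z=\mathrm{diag}(1,-1)$, $\sigma^+=\begin{pmatrix}0&1\\0&0\end{pmatrix}$, $\sigma^-=\begin{pmatrix}0&0\\1&0\end{pmatrix}$ acting on the $n$-th factor, and for $\lambda\in\mathbb C\setminus\{0\}$ put $x_\pm(\lambda)=\tfrac12\big(\lambda q-(q\lambda)^{-1}\pm(\lambda-\lambda^{-1})\big)$, $$\mathsf L_{0n}(\lambda)=\begin{pmatrix} x_+(\lambda)+x_-(\lambda)\sigma_n^z & (q-q^{-1})\sigma_n^-\\ (q-q^{-1})\sigma_n^+ & x_+(\lambda)-x_-(\lambda)\sigma_n^z\end{pmatrix},\qquad \begin{pmatrix}\mathsf A(\lambda)&\mathsf B(\lambda)\\ \mathsf C(\lambda)&\mathsf D(\lambda)\end{pmatrix}=\mathsf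 L_{0\mathsf N}(\lambda/\eta_{\mathsf N})\cdots \mathsf L_{01}(\lambda/\eta_1).$$ Suppose that $$\eta_a\neq \pm q^{j}\eta_b\qquad\text{for all } j\in\{-1,0,1\}\text{ and all } a<b \text{ in } \{1,\dots,\mathsf N\}.$$ Then an SOV representation exists for the spectral problem of the antiperiodic transfer matrix $\bar{\mathsf T}(\lambda)=\mathsf B(\lambda)+\mathsf C(\lambda)$, that is: the family $\mathsf D(\lambda)$, $\lambda\in\mathbb C\setminus\{0\}$, is diagonalizable with simple spectrum, and so is the family $\mathsf A(\lambda)$, $\lambda\in\mathbb C\setminus\{0\}$. Here a family of operators is called diagonalizable with simple spectrum if $\mathcal R_{\mathsf N}$ has a basis of common eigenvectors, independent of $\lambda$, such that the eigenvalue functions of $\lambda$ belonging to two different basis vectors are different; moreover, they take the same value for at most finitely many $\lambda\in\mathbb C\setminus\{0\}$. -/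

import Mathlib

open scoped Matrix

namespace SixVertex

/-- Spin configurations of a chain of `N` sites; at each site `0` is the spin up (`σᶻ = 1`) and
`1` the spin down (`σᶻ = -1`). They index the standard product basis of the quantum space
`ℂ² ⊗ ⋯ ⊗ ℂ²` (`N` factors), which is therefore written `Config N → ℂ`. -/
abbrev Config (N : ℕ) : Type := Fin N → Fin 2

/-- Operators on the quantum space, as matrices in the product spin basis. -/
abbrev Operator (N : ℕ) : Type := Matrix (Config N) (Config N) ℂ

/-- The Pauli matrix `σᶻ`. -/
def sigmaZ : Matrix (Fin 2) (Fin 2) ℂ := !![1, 0; 0, -1]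

/-- The raising matrix `σ⁺`. -/
def sigmaPlus : Matrix (Fin 2) (Fin 2) ℂ := !![0, 1; 0, 0]

/-- The lowering matrix `σ⁻`. -/
def sigmaMinus : Matrix (Fin 2) (Fin 2) ℂ := !![0, 0; 1, 0]

/-- The operator `1 ⊗ ⋯ ⊗ S ⊗ ⋯ ⊗ 1` that acts by the `2 × 2` matrix `S` on the site `n` and as
the identity on all other sites. -/
def siteOp {N : ℕ} (n : Fin N) (S : Matrix (Fin 2) (Fin 2) ℂ) : Operator N :=
  Matrix.of fun s t => if ∀ m, m ≠ n → s m = t m then S (s n) (t n) else 0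

/-- `x₊(u) = (u q - (q u)⁻¹ + u - u⁻¹) / 2`. -/
noncomputable def xPlus (q u : ℂ) : ℂ := (u * q - (q * u)⁻¹ + u - u⁻¹) / 2

/-- `x₋(u) = (u q - (q u)⁻¹ - u + u⁻¹) / 2`. -/
noncomputable def xMinus (q u : ℂ) : ℂ := (u * q - (q * u)⁻¹ - u + u⁻¹) / 2

/-- The six-vertex Lax operator of the site `n`, as a `2 × 2` matrix (in the auxiliary space)
whose entries are operators on the quantum space. -/
noncomputable def lax {N : ℕ} (q : ℂ) (n : Fin N) (u : ℂ) :
    Matrix (Fin 2) (Fin 2) (Operator N) :=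
  !![siteOp n (xPlus q u • 1 + xMinus q u • sigmaZ), siteOp n ((q - q⁻¹) • sigmaMinus);
     siteOp n ((q - q⁻¹) • sigmaPlus), siteOp n (xPlus q u • 1 - xMinus q u • sigmaZ)]

/-- The monodromy matrix `L_N(u / η_N) ⋯ L_1(u / η_1)`. -/
noncomputable def monodromy {N : ℕ} (q : ℂ) (η : Fin N → ℂ) (u : ℂ) :
    Matrix (Fin 2) (Fin 2) (Operator N) :=
  (List.ofFn fun n : Fin N => lax q n (u / η n)).reverse.prod

/-- The entry `A(u)` of the monodromy matrix. -/
noncomputable def opA {N : ℕ} (q : ℂ) (η : Fin N → ℂ) (u : ℂ) : Operator N :=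
  monodromy q η u 0 0

/-- The entry `D(u)` of the monodromy matrix. -/
noncomputable def opD {N : ℕ} (q : ℂ) (η : Fin N → ℂ) (u : ℂ) : Operator N :=
  monodromy q η u 1 1

/-- `b` is a basis of the quantum space in which all the operators `X u`, `u ≠ 0`, are
diagonal, and the spectrum of the family is simple: two different basis vectors have different
eigenvalue functions of `u`, and their eigenvalues coincide for at most finitely many `u ≠ 0`
(so that the single operator `X u` has `2 ^ N` distinct eigenvalues for all but finitely
many `u`). -/
def IsSOVBasis {N : ℕ} (X : ℂ → Operator N)
    (b : Module.Basis (Config N) ℂ (Config N → ℂ)) : Prop :=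
  ∃ δ : Config N → ℂ → ℂ,
    (∀ u : ℂ, u ≠ 0 → ∀ h, X u *ᵥ b h = δ h u • b h) ∧
    ∀ h k, h ≠ k → {u : ℂ | u ≠ 0 ∧ δ h u = δ k u}.Finite

end SixVertex

namespace SixVertex

/-! Both families are diagonal entries `(e, e)` of the monodromy matrix, with `e = 0` for A and `e =
1` for D, so one argument covers both. Diagonal Lax entries are diagonal in the spin basis, and
off-diagonal ones flip one spin. Since the sites are multiplied in decreasing order, a path from
auxiliary state `e` back to `e` that flips spins lowers the total position of the sites in state `e`
(`listMonodromy_triangular`). The family is therefore triangular, and its diagonal entries are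
explicit products over the sites.

At `u = η n` such a product vanishes or not according to the spin at site `n`; this is where the
condition on the inhomogeneities enters (`finite_eigenvalue_eq`). The Yang-Baxter relation makes the
family commute (`listMonodromy_diagonal_commute`). Eigenvectors at one parameter with distinct
diagonal entries are then shared by the whole family (`exists_common_eigenbasis`). -/

/-! ### Linear algebra of weight triangular matrices. -/

/-- The determinant of a matrix that is triangular with respect to a weight function. -/
theorem det_of_weight_triangular {ι R : Type*} [Fintype ι] [DecidableEq ι] [CommRing R]
    (w : ι → ℕ) (M : Matrix ι ι R) (hM : ∀ s t, s ≠ t → M s t ≠ 0 → w s < w t) :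
    M.det = ∏ i, M i i := by
  rw [Matrix.det_apply, Finset.sum_eq_single 1]
  · simp
  · intro σ _ hσ
    by_contra hne
    have hfac : ∀ i, M (σ i) i ≠ 0 := by
      intro i hi
      apply hne
      have : ∏ i, M (σ i) i = 0 := Finset.prod_eq_zero (Finset.mem_univ i) hi
      rw [this, smul_zero]
    have hle : ∀ i ∈ Finset.univ, w (σ i) ≤ w i := by
      intro i _
      by_cases h : σ i = i
      · rw [h]
      · exact (hM _ _ h (hfac i)).le
    obtain ⟨i, hi⟩ : ∃ i, σ i ≠ i := by
      by_contra! h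
      exact hσ (Equiv.ext h)
    -- A permutation preserves the total weight, so it cannot lower some weights and raise none.
    have := Finset.sum_lt_sum hle ⟨i, Finset.mem_univ i, hM _ _ hi (hfac i)⟩
    rw [Equiv.sum_comp σ w] at this
    exact lt_irrefl _ this
  · simp

/-- An eigenvector of a weight triangular matrix, for a simple diagonal entry, is led by the
coordinate of that entry. -/
theorem leading_coordinate {ι K : Type*} [Fintype ι] [Field K]
    (w : ι → ℕ) (M : Matrix ι ι K) (hM : ∀ s t, s ≠ t → M s t ≠ 0 → w s < w t) (h : ι)
    (hs : ∀ k, k ≠ h → M k k ≠ M h h) (v : ι → K) (hv : M *ᵥ v = M h h • v) (hv0 : v ≠ 0) :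
    v h ≠ 0 ∧ ∀ s, v s ≠ 0 → w s ≤ w h := by
  classical
  obtain ⟨i, hi⟩ := Function.ne_iff.1 hv0
  obtain ⟨s, hsm, hmax⟩ := Finset.exists_max_image (Finset.univ.filter fun i => v i ≠ 0) w
    ⟨i, by simpa using hi⟩
  have hvs : v s ≠ 0 := by simpa using hsm
  have hmax' : ∀ t, v t ≠ 0 → w t ≤ w s := fun t ht => hmax t (by simpa using ht)
  -- At a support coordinate of maximal weight, row `s` of the eigenvalue equation retains only its
  -- diagonal term.
  have hd : M s s * v s = M h h * v s := by
    have := congrFun hv s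
    rw [Matrix.mulVec, dotProduct, Finset.sum_eq_single s] at this
    · simpa using this
    · intro t _ hts
      by_contra hne
      exact absurd (hM s t hts.symm (left_ne_zero_of_mul hne))
        (not_lt.2 (hmax' t (right_ne_zero_of_mul hne)))
    · simp
  have : s = h := by
    by_contra hne
    exact hs s hne (mul_right_cancel₀ hvs hd)
  subst this
  exact ⟨hvs, hmax'⟩

/-- A commuting family of weight triangular matrices whose diagonal entries coincide for at most
finitely many nonzero parameters has a basis of common eigenvectors. -/
theorem exists_common_eigenbasis {ι K : Type*} [Fintype ι] [DecidableEq ι] [Field K] [Infinite K]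
    (w : ι → ℕ) (X : K → Matrix ι ι K)
    (hX : ∀ u s t, s ≠ t → X u s t ≠ 0 → w s < w t)
    (hcomm : ∀ u v, u ≠ 0 → v ≠ 0 → X u * X v = X v * X u)
    (hfin : ∀ h k, h ≠ k → {u : K | u ≠ 0 ∧ X u h h = X u k k}.Finite) :
    ∃ b : Module.Basis ι K (ι → K), ∀ u, u ≠ 0 → ∀ h, X u *ᵥ b h = X u h h • b h := by
  classical
  obtain ⟨u₀, hu₀, hsep⟩ : ∃ u₀ : K, u₀ ≠ 0 ∧ ∀ h k, h ≠ k → X u₀ h h ≠ X u₀ k k := by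
    have hF : ({0} ∪ ⋃ h, ⋃ k, {u : K | h ≠ k ∧ u ≠ 0 ∧ X u h h = X u k k}).Finite := by
      refine (Set.finite_singleton 0).union
        (Set.finite_iUnion fun h => Set.finite_iUnion fun k => ?_)
      by_cases hk : h = k
      · simp [hk]
      · exact (hfin h k hk).subset fun u hu => hu.2
    obtain ⟨u₀, hu⟩ := hF.exists_notMem
    simp only [Set.mem_union, Set.mem_singleton_iff, Set.mem_iUnion, Set.mem_ofPred_eq,
      not_or, not_exists, not_and] at hu
    exact ⟨u₀, hu.1, fun h k hk => hu.2 h k hk hu.1⟩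
  have hex : ∀ h, ∃ v : ι → K, v ≠ 0 ∧ X u₀ *ᵥ v = X u₀ h h • v := by
    intro h
    have hdet : (X u₀ - X u₀ h h • (1 : Matrix ι ι K)).det = 0 := by
      rw [det_of_weight_triangular w]
      · exact Finset.prod_eq_zero (Finset.mem_univ h) (by simp)
      · intro s t hst hne
        exact hX u₀ s t hst (by simpa [Matrix.one_apply_ne hst] using hne)
    obtain ⟨v, hv0, hv⟩ := Matrix.exists_mulVec_eq_zero_iff.2 hdet
    refine ⟨v, hv0, ?_⟩
    rw [Matrix.sub_mulVec, Matrix.smul_mulVec, Matrix.one_mulVec] at hv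
    exact sub_eq_zero.1 hv
  choose v hv0 hv using hex
  have hli : LinearIndependent K v :=
    Module.End.eigenvectors_linearIndependent' (Matrix.toLin' (X u₀)) (fun h => X u₀ h h)
      (fun h k hk => by_contra fun hne => hsep h k hne hk) v
      fun h => ⟨Module.End.mem_eigenspace_iff.2 (by simpa using hv h), hv0 h⟩
  refine ⟨basisOfPiSpaceOfLinearIndependent hli, fun u hu h => ?_⟩
  rw [coe_basisOfPiSpaceOfLinearIndependent]
  by_contra hne
  have hsep' : ∀ k, k ≠ h → X u₀ k k ≠ X u₀ h h := fun k hk => hsep k h hk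
  have hlead := (leading_coordinate w _ (hX u₀) h hsep' _ (hv h) (hv0 h)).2
  -- By commutation the defect `X u *ᵥ v h - X u h h • v h` satisfies the same eigenvalue equation
  -- for `X u₀`. Its coordinate `h` vanishes, because `v h` has no support above weight `w h`; so
  -- the defect is zero.
  refine (leading_coordinate w _ (hX u₀) h hsep' (X u *ᵥ v h - X u h h • v h) ?_
    (sub_ne_zero.2 hne)).1 ?_
  · rw [Matrix.mulVec_sub, Matrix.mulVec_mulVec, hcomm _ _ hu₀ hu, ← Matrix.mulVec_mulVec, hv,
      Matrix.mulVec_smul, Matrix.mulVec_smul, hv, smul_sub, smul_comm]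
  · rw [Pi.sub_apply, Matrix.mulVec, dotProduct, Finset.sum_eq_single h]
    · simp
    · intro t _ hth
      by_contra hne'
      exact absurd (hX u h t hth.symm (left_ne_zero_of_mul hne'))
        (not_lt.2 (hlead t (right_ne_zero_of_mul hne')))
    · simp

/-! ### Operators acting on a single site. -/

theorem siteOp_mul {N : ℕ} (n : Fin N) (S T : Matrix (Fin 2) (Fin 2) ℂ) :
    siteOp n S * siteOp n T = siteOp n (S * T) := by
  ext s t
  simp only [siteOp, Matrix.mul_apply, Matrix.of_apply]
  split_ifs with h
  · rw [← Finset.sum_subset (Finset.subset_univ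
      (Finset.univ.image fun x : Fin 2 => Function.update s n x)), Finset.sum_image]
    · refine Finset.sum_congr rfl fun x _ => ?_
      rw [if_pos, if_pos]
      · simp
      · intro m hm
        simpa [hm] using h m hm
      · intro m hm
        simp [hm]
    · intro x _ y _ hxy
      simpa using congrFun hxy n
    · intro r _ hr
      rw [if_neg, zero_mul]
      intro hs
      apply hr
      simp only [Finset.mem_image, Finset.mem_univ, true_and]
      refine ⟨r n, funext fun m => ?_⟩
      by_cases hm : m = n
      · subst hm; simp
      · simp [hm, hs m hm]
  · refine Finset.sum_eq_zero fun r _ => ?_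
    by_contra hne
    apply h
    intro m hm
    by_contra hst
    by_cases h1 : s m = r m
    · have h2 : ¬ ∀ m, m ≠ n → r m = t m := fun h' => hst (h1.trans (h' m hm))
      exact hne (by rw [if_neg h2, mul_zero])
    · have h2 : ¬ ∀ m, m ≠ n → s m = r m := fun h' => h1 (h' m hm)
      exact hne (by rw [if_neg h2, zero_mul])

theorem siteOp_add {N : ℕ} (n : Fin N) (S T : Matrix (Fin 2) (Fin 2) ℂ) :
    siteOp n S + siteOp n T = siteOp n (S + T) := by
  ext s t
  simp only [siteOp, Matrix.add_apply, Matrix.of_apply]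
  split_ifs <;> simp

theorem siteOp_smul {N : ℕ} (n : Fin N) (c : ℂ) (S : Matrix (Fin 2) (Fin 2) ℂ) :
    c • siteOp n S = siteOp n (c • S) := by
  ext s t
  simp [siteOp]

theorem siteOp_mul_apply_of_ne {N : ℕ} {n m : Fin N} (hnm : n ≠ m)
    (S T : Matrix (Fin 2) (Fin 2) ℂ) (s t : Config N) :
    (siteOp n S * siteOp m T) s t =
      if ∀ k, k ≠ n → k ≠ m → s k = t k then S (s n) (t n) * T (s m) (t m) else 0 := by
  simp only [siteOp, Matrix.mul_apply, Matrix.of_apply]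
  rw [Finset.sum_eq_single (Function.update s n (t n))]
  · rw [if_pos fun k hk => by simp [hk]]
    have : (∀ k, k ≠ m → Function.update s n (t n) k = t k) ↔
        ∀ k, k ≠ n → k ≠ m → s k = t k := by
      refine forall_congr' fun k => ?_
      by_cases hk : k = n
      · subst hk; simp
      · simp [hk]
    simp only [this, Function.update_self, Function.update_of_ne hnm.symm]
    split_ifs <;> simp
  · intro r _ hr
    by_contra hne
    have h1 : ∀ k, k ≠ n → s k = r k := by
      by_contra h; exact hne (by rw [if_neg h, zero_mul])
    have h2 : ∀ k, k ≠ m → r k = t k := by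
      by_contra h; exact hne (by rw [if_neg h, mul_zero])
    apply hr
    funext k
    by_cases hk : k = n
    · subst hk; simp [h2 k hnm]
    · simp [hk, h1 k hk]
  · simp

theorem siteOp_commute {N : ℕ} {n m : Fin N} (hnm : n ≠ m) (S T : Matrix (Fin 2) (Fin 2) ℂ) :
    Commute (siteOp n S) (siteOp m T) := by
  ext s t
  rw [siteOp_mul_apply_of_ne hnm, siteOp_mul_apply_of_ne hnm.symm]
  simp only [mul_comm (T _ _)]
  congr 1
  exact propext (forall_congr' fun k => ⟨fun h a b => h b a, fun h a b => h b a⟩)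

/-! ### Yang-Baxter relation and commutativity. -/

/-- The one-site Lax matrix, before it is placed at a site of the chain. -/
noncomputable def localLax (q u : ℂ) : Matrix (Fin 2) (Fin 2) (Matrix (Fin 2) (Fin 2) ℂ) :=
  !![xPlus q u • 1 + xMinus q u • sigmaZ, (q - q⁻¹) • sigmaMinus;
     (q - q⁻¹) • sigmaPlus, xPlus q u • 1 - xMinus q u • sigmaZ]

theorem lax_apply {N : ℕ} (q : ℂ) (n : Fin N) (u : ℂ) (i j : Fin 2) :
    lax q n u i j = siteOp n (localLax q u i j) := by
  fin_cases i <;> fin_cases j <;> rfl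

/-- The product of two matrices with noncommuting entries that act on different auxiliary spaces,
entries of the first one to the left. -/
def auxMul {A : Type*} [Mul A] (T T' : Matrix (Fin 2) (Fin 2) A) :
    Matrix (Fin 2 × Fin 2) (Fin 2 × Fin 2) A :=
  Matrix.of fun i j => T i.1 j.1 * T' i.2 j.2

/-- The product of two matrices with noncommuting entries that act on different auxiliary spaces,
entries of the second one to the left. -/
def auxMulRev {A : Type*} [Mul A] (T T' : Matrix (Fin 2) (Fin 2) A) :
    Matrix (Fin 2 × Fin 2) (Fin 2 × Fin 2) A :=
  Matrix.of fun i j => T' i.2 j.2 * T i.1 j.1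

theorem auxMul_mul {A : Type*} [Semiring A] (S T S' T' : Matrix (Fin 2) (Fin 2) A)
    (h : ∀ i j k l, Commute (T i j) (S' k l)) :
    auxMul (S * T) (S' * T') = auxMul S S' * auxMul T T' := by
  ext ⟨i, j⟩ ⟨k, l⟩
  simp only [auxMul, Matrix.mul_apply, Matrix.of_apply, Fintype.sum_prod_type,
    Finset.sum_mul_sum]
  refine Finset.sum_congr rfl fun a _ => Finset.sum_congr rfl fun b _ => ?_
  rw [mul_assoc, ← mul_assoc (T a k), (h a k j b).eq, mul_assoc, mul_assoc]

theorem auxMulRev_mul {A : Type*} [Semiring A] (S T S' T' : Matrix (Fin 2) (Fin 2) A)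
    (h : ∀ i j k l, Commute (T' i j) (S k l)) :
    auxMulRev (S * T) (S' * T') = auxMulRev S S' * auxMulRev T T' := by
  ext ⟨i, j⟩ ⟨k, l⟩
  simp only [auxMulRev, Matrix.mul_apply, Matrix.of_apply, Fintype.sum_prod_type,
    Finset.sum_mul_sum]
  rw [Finset.sum_comm]
  refine Finset.sum_congr rfl fun a _ => Finset.sum_congr rfl fun b _ => ?_
  rw [mul_assoc, ← mul_assoc (T' b l), (h b l i a).eq, mul_assoc, mul_assoc]

/-- The six-vertex `R`-matrix. -/
noncomputable def rMatrix (q u : ℂ) : Matrix (Fin 2 × Fin 2) (Fin 2 × Fin 2) ℂ :=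
  Matrix.of fun i j => localLax q u i.1 j.1 i.2 j.2

/-- The Yang-Baxter exchange relation of two matrices, with intertwiner `R`. -/
def Exchange {A : Type*} [Ring A] [Algebra ℂ A] (R : Matrix (Fin 2 × Fin 2) (Fin 2 × Fin 2) ℂ)
    (T T' : Matrix (Fin 2) (Fin 2) A) : Prop :=
  R.map (algebraMap ℂ A) * auxMul T T' = auxMulRev T T' * R.map (algebraMap ℂ A)

/-- Ultralocality: entries at different sites commute, so the intertwiner passes through the two
factors one after the other. -/
theorem Exchange.mul {A : Type*} [Ring A] [Algebra ℂ A]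
    {R : Matrix (Fin 2 × Fin 2) (Fin 2 × Fin 2) ℂ} {S T S' T' : Matrix (Fin 2) (Fin 2) A}
    (hS : Exchange R S S') (hT : Exchange R T T')
    (h : ∀ i j k l, Commute (T i j) (S' k l)) (h' : ∀ i j k l, Commute (T' i j) (S k l)) :
    Exchange R (S * T) (S' * T') := by
  rw [Exchange, auxMul_mul _ _ _ _ h, auxMulRev_mul _ _ _ _ h', ← mul_assoc, hS, mul_assoc, hT,
    mul_assoc]

theorem Exchange.one {A : Type*} [Ring A] [Algebra ℂ A]
    (R : Matrix (Fin 2 × Fin 2) (Fin 2 × Fin 2) ℂ) :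
    Exchange R (1 : Matrix (Fin 2) (Fin 2) A) 1 := by
  have h1 : auxMul (1 : Matrix (Fin 2) (Fin 2) A) 1 = 1 := by
    ext ⟨i, j⟩ ⟨k, l⟩
    simp [auxMul, Matrix.one_apply, Prod.ext_iff, ite_and]
    split_ifs <;> rfl
  have h2 : auxMulRev (1 : Matrix (Fin 2) (Fin 2) A) 1 = 1 := by
    ext ⟨i, j⟩ ⟨k, l⟩
    simp [auxMulRev, Matrix.one_apply, Prod.ext_iff, ite_and]
  rw [Exchange, h1, h2, mul_one, one_mul]

theorem localLax_eq (q u : ℂ) :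
    localLax q u =
      !![!![q * u - (q * u)⁻¹, 0; 0, u - u⁻¹], !![0, 0; q - q⁻¹, 0];
         !![0, q - q⁻¹; 0, 0], !![u - u⁻¹, 0; 0, q * u - (q * u)⁻¹]] := by
  ext i j x y
  fin_cases i <;> fin_cases j <;> fin_cases x <;> fin_cases y <;>
    simp [localLax, sigmaZ, sigmaPlus, sigmaMinus, xPlus, xMinus] <;> ring

set_option maxHeartbeats 4000000 in
/-- The Yang-Baxter equation for the one-site Lax matrix. -/
theorem localLax_exchange (q u v : ℂ) (hq : q ≠ 0) (hu : u ≠ 0) (hv : v ≠ 0) :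
    Exchange (rMatrix q (u / v)) (localLax q u) (localLax q v) := by
  unfold Exchange
  ext I J : 1
  simp only [Matrix.mul_apply, Matrix.map_apply, ← Algebra.smul_def, ← Algebra.commutes]
  ext x y
  obtain ⟨i, j⟩ := I
  obtain ⟨k, l⟩ := J
  fin_cases i <;> fin_cases j <;> fin_cases k <;> fin_cases l <;> fin_cases x <;> fin_cases y <;>
    simp [Fintype.sum_prod_type, auxMul, auxMulRev, rMatrix, localLax_eq, -mul_eq_mul_left_iff,
      -mul_eq_mul_right_iff] <;>
    field_simp <;> ring

/-- The product of the Lax operators of a list of sites. -/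
noncomputable def listMonodromy {N : ℕ} (q : ℂ) (η : Fin N → ℂ) (l : List (Fin N)) (u : ℂ) :
    Matrix (Fin 2) (Fin 2) (Operator N) :=
  (l.map fun n => lax q n (u / η n)).prod

theorem monodromy_eq_listMonodromy {N : ℕ} (q : ℂ) (η : Fin N → ℂ) (u : ℂ) :
    monodromy q η u = listMonodromy q η (List.finRange N).reverse u := by
  rw [monodromy, listMonodromy, List.ofFn_eq_map, List.map_reverse]

theorem listMonodromy_cons {N : ℕ} (q : ℂ) (η : Fin N → ℂ) (n : Fin N) (l : List (Fin N))
    (u : ℂ) :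
    listMonodromy q η (n :: l) u = lax q n (u / η n) * listMonodromy q η l u := by
  simp [listMonodromy]

theorem listMonodromy_commute {N : ℕ} (q : ℂ) (η : Fin N → ℂ) (n : Fin N) (l : List (Fin N))
    (hn : n ∉ l) (u : ℂ) (S : Matrix (Fin 2) (Fin 2) ℂ) (i j : Fin 2) :
    Commute (listMonodromy q η l u i j) (siteOp n S) := by
  induction l generalizing i j with
  | nil =>
    simp only [listMonodromy, List.map_nil, List.prod_nil, Matrix.one_apply]
    split_ifs
    · exact Commute.one_left _
    · exact Commute.zero_left _
  | cons m l ih =>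
    rw [List.mem_cons, not_or] at hn
    rw [listMonodromy_cons, Matrix.mul_apply]
    refine Commute.sum_left _ _ _ fun k _ => Commute.mul_left ?_ (ih hn.2 k j)
    rw [lax_apply]
    exact siteOp_commute (Ne.symm hn.1) _ _

/-- `siteOp n` is linear and multiplicative, so it carries the one-site relation into the chain. -/
theorem lax_exchange {N : ℕ} (n : Fin N) (q u v : ℂ) (hq : q ≠ 0) (hu : u ≠ 0) (hv : v ≠ 0) :
    Exchange (rMatrix q (u / v)) (lax q n u) (lax q n v) := by
  have h := localLax_exchange q u v hq hu hv
  unfold Exchange at h ⊢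
  ext1 I J
  have h' := congrArg (siteOp n) (congrFun (congrFun h I) J)
  simp only [Matrix.mul_apply, Matrix.map_apply, ← Algebra.smul_def, ← Algebra.commutes,
    Fintype.sum_prod_type, Fin.sum_univ_two, auxMul, auxMulRev, Matrix.of_apply, lax_apply,
    siteOp_mul, siteOp_smul, siteOp_add] at h' ⊢
  exact h'

theorem listMonodromy_exchange {N : ℕ} (q : ℂ) (hq : q ≠ 0) (η : Fin N → ℂ)
    (hη : ∀ n, η n ≠ 0) (l : List (Fin N)) (hl : l.Nodup) (u v : ℂ) (hu : u ≠ 0) (hv : v ≠ 0) :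
    Exchange (rMatrix q (u / v)) (listMonodromy q η l u) (listMonodromy q η l v) := by
  induction l with
  | nil => exact Exchange.one _
  | cons n l ih =>
    rw [List.nodup_cons] at hl
    rw [listMonodromy_cons, listMonodromy_cons]
    have h := lax_exchange n q (u / η n) (v / η n) hq (div_ne_zero hu (hη n))
      (div_ne_zero hv (hη n))
    rw [div_div_div_cancel_right₀ (hη n)] at h
    refine h.mul (ih hl.2) ?_ ?_ <;> intro i j k m <;> rw [lax_apply] <;>
      exact listMonodromy_commute q η n l hl.1 _ _ _ _

theorem continuousAt_siteOp {N : ℕ} (n : Fin N) {S : ℂ → Matrix (Fin 2) (Fin 2) ℂ} {u : ℂ}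
    (hS : ContinuousAt S u) : ContinuousAt (fun u => siteOp n (S u)) u := by
  refine continuousAt_pi.2 fun s => continuousAt_pi.2 fun t => ?_
  simp only [siteOp, Matrix.of_apply]
  split_ifs
  · exact continuousAt_pi.1 (continuousAt_pi.1 hS _) _
  · exact continuousAt_const

theorem continuousAt_localLax (q : ℂ) (hq : q ≠ 0) {u : ℂ} (hu : u ≠ 0) (i j : Fin 2) :
    ContinuousAt (fun u => localLax q u i j) u := by
  refine continuousAt_pi.2 fun x => continuousAt_pi.2 fun y => ?_
  have h1 : ContinuousAt (fun u : ℂ => u - u⁻¹) u := continuousAt_id.sub (continuousAt_inv₀ hu)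
  have h2 : ContinuousAt (fun u : ℂ => q * u - (q * u)⁻¹) u :=
    (continuousAt_const.mul continuousAt_id).sub
      ((continuousAt_const.mul continuousAt_id).inv₀ (mul_ne_zero hq hu))
  simp only [localLax_eq]
  fin_cases i <;> fin_cases j <;> fin_cases x <;> fin_cases y <;>
    first | exact h1 | exact h2 | exact continuousAt_const

theorem continuousAt_listMonodromy {N : ℕ} (q : ℂ) (hq : q ≠ 0) (η : Fin N → ℂ)
    (hη : ∀ n, η n ≠ 0) (l : List (Fin N)) {u : ℂ} (hu : u ≠ 0) (i j : Fin 2) :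
    ContinuousAt (fun u => listMonodromy q η l u i j) u := by
  induction l generalizing i j with
  | nil => exact continuousAt_const
  | cons n l ih =>
    simp only [listMonodromy_cons, Matrix.mul_apply, Fin.sum_univ_two, lax_apply]
    have hs : ∀ k, ContinuousAt (fun u => siteOp n (localLax q (u / η n) i k)) u := fun k =>
      continuousAt_siteOp n (S := fun u => localLax q (u / η n) i k)
        (ContinuousAt.comp (f := fun u => u / η n) (g := fun u => localLax q u i k)
          (continuousAt_localLax q hq (div_ne_zero hu (hη n)) i k)
          (continuousAt_id.div_const _))
    exact ((hs 0).mul (ih 0 j)).add ((hs 1).mul (ih 1 j))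

/-- The diagonal entries of the monodromy matrix form commuting families. -/
theorem listMonodromy_diagonal_commute {N : ℕ} (q : ℂ) (hq : q ≠ 0) (η : Fin N → ℂ)
    (hη : ∀ n, η n ≠ 0) (l : List (Fin N)) (hl : l.Nodup) (e : Fin 2) (u v : ℂ)
    (hu : u ≠ 0) (hv : v ≠ 0) :
    listMonodromy q η l u e e * listMonodromy q η l v e e =
      listMonodromy q η l v e e * listMonodromy q η l u e e := by
  -- The `(e, e), (e, e)` component of the exchange relation is the commutation relation times a
  -- scalar, which is zero exactly when `q ^ 2 * w ^ 2 = v ^ 2`. These exceptional parameters are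
  -- recovered by continuity in `w`.
  have hgen : ∀ w : ℂ, w ≠ 0 → q ^ 2 * w ^ 2 ≠ v ^ 2 →
      listMonodromy q η l w e e * listMonodromy q η l v e e =
        listMonodromy q η l v e e * listMonodromy q η l w e e := by
    intro w hw hwv
    have ha : q * (w / v) - (q * (w / v))⁻¹ ≠ 0 := by
      intro h
      apply hwv
      field_simp at h
      linear_combination h
    have h := congrFun (congrFun (listMonodromy_exchange q hq η hη l hl w v hw hv) (e, e)) (e, e)
    simp only [Matrix.mul_apply, Matrix.map_apply, ← Algebra.smul_def, ← Algebra.commutes,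
      Fintype.sum_prod_type, Fin.sum_univ_two, auxMul, auxMulRev, Matrix.of_apply, rMatrix,
      localLax_eq] at h
    refine smul_right_injective _ ha ?_
    fin_cases e <;> simpa using h
  have hc : ContinuousAt (fun w => listMonodromy q η l w e e * listMonodromy q η l v e e -
      listMonodromy q η l v e e * listMonodromy q η l w e e) u := by
    have := continuousAt_listMonodromy q hq η hη l hu e e
    exact (this.mul continuousAt_const).sub (continuousAt_const.mul this)
  have hne : ∀ᶠ w in nhdsWithin u {u}ᶜ, w ≠ 0 ∧ q ^ 2 * w ^ 2 ≠ v ^ 2 := by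
    have hF : ({0, v / q, -(v / q)} : Set ℂ).Finite := by simp
    have hF' : (({0, v / q, -(v / q)} : Set ℂ) \ {u})ᶜ ∈ nhds u :=
      (hF.subset Set.sdiff_subset).isClosed.isOpen_compl.mem_nhds (by simp)
    filter_upwards [nhdsWithin_le_nhds hF', self_mem_nhdsWithin] with w hw hwu
    have hw' : w ∉ ({0, v / q, -(v / q)} : Set ℂ) := fun h => hw ⟨h, hwu⟩
    simp only [Set.mem_insert_iff, Set.mem_singleton_iff, not_or] at hw'
    refine ⟨hw'.1, fun h => ?_⟩
    rw [← mul_pow, sq_eq_sq_iff_eq_or_eq_neg] at h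
    rcases h with h | h
    · exact hw'.2.1 (by rw [← h]; field_simp)
    · exact hw'.2.2 (by rw [← neg_div, ← h]; field_simp)
  refine sub_eq_zero.1 (tendsto_nhds_unique (l := nhdsWithin u {u}ᶜ)
    (hc.tendsto.mono_left nhdsWithin_le_nhds)
    (tendsto_const_nhds.congr' ?_))
  filter_upwards [hne] with w hw
  exact (sub_eq_zero.2 (hgen w hw.1 hw.2)).symm

/-! ### Triangularity and diagonal entries in the spin basis. -/

/-- The sum of the positions of the sites that are in the state `e`. -/
def weight {N : ℕ} (e : Fin 2) (s : Config N) : ℕ :=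
  ∑ n, if s n = e then (n : ℕ) else 0

theorem weight_eq_add {N : ℕ} {e : Fin 2} {n : Fin N} {s r : Config N} (hs : s n = e)
    (hr : r n ≠ e) (h : ∀ m, m ≠ n → s m = r m) : weight e s = weight e r + n := by
  rw [weight, weight, ← Finset.add_sum_erase _ _ (Finset.mem_univ n),
    ← Finset.add_sum_erase Finset.univ (fun n => if r n = e then (n : ℕ) else 0)
      (Finset.mem_univ n), if_pos hs, if_neg hr, zero_add, add_comm]
  congr 1
  exact Finset.sum_congr rfl fun m hm => by rw [h m (Finset.ne_of_mem_erase hm)]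

/-- The eigenvalue of the diagonal Lax entry `(e, e)` on the spin state `x`. -/
noncomputable def laxEigenvalue (q : ℂ) (e x : Fin 2) (u : ℂ) : ℂ :=
  if x = e then q * u - (q * u)⁻¹ else u - u⁻¹

theorem lax_diagonal {N : ℕ} (q : ℂ) (n : Fin N) (u : ℂ) (e : Fin 2) :
    lax q n u e e = Matrix.diagonal fun s => laxEigenvalue q e (s n) u := by
  have hd : localLax q u e e = Matrix.diagonal fun x => laxEigenvalue q e x u := by
    rw [localLax_eq]
    ext x y
    fin_cases e <;> fin_cases x <;> fin_cases y <;> simp [laxEigenvalue]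
  rw [lax_apply, hd]
  ext s t
  by_cases hst : s = t
  · subst hst; simp [siteOp]
  · rw [Matrix.diagonal_apply_ne _ hst, siteOp, Matrix.of_apply]
    split_ifs with h
    · refine Matrix.diagonal_apply_ne _ fun hn => hst (funext fun m => ?_)
      by_cases hm : m = n
      · rw [hm, hn]
      · exact h m hm
    · rfl

theorem lax_offDiagonal {N : ℕ} (q : ℂ) (n : Fin N) (u : ℂ) {i j : Fin 2} (hij : i ≠ j)
    {s r : Config N} (h : lax q n u i j s r ≠ 0) :
    s n = j ∧ r n = i ∧ ∀ m, m ≠ n → s m = r m := by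
  rw [lax_apply, siteOp, Matrix.of_apply] at h
  have hloc : ∀ x y, localLax q u i j x y ≠ 0 → x = j ∧ y = i := by
    intro x y
    rw [localLax_eq]
    fin_cases i <;> fin_cases j <;> fin_cases x <;> fin_cases y <;> simp at hij ⊢
  split_ifs at h with hm
  · exact ⟨(hloc _ _ h).1, (hloc _ _ h).2, hm⟩
  · exact absurd rfl h

/-- The column `e` of the monodromy matrix of a decreasing list of sites is triangular. -/
theorem listMonodromy_triangular {N : ℕ} (q : ℂ) (η : Fin N → ℂ) (u : ℂ) (e : Fin 2)
    (l : List (Fin N)) (hl : l.Pairwise (· > ·)) (s t : Config N) :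
    (listMonodromy q η l u e e s t ≠ 0 → s = t ∨ weight e s < weight e t) ∧
      ∀ i, i ≠ e → ∀ k : ℕ, (∀ m ∈ l, (m : ℕ) < k) → listMonodromy q η l u i e s t ≠ 0 →
        weight e s < weight e t + k := by
  induction l generalizing s with
  | nil =>
    refine ⟨fun h => ?_, fun i hi k _ h => ?_⟩
    · by_contra hst
      rw [not_or] at hst
      exact h (by simp [listMonodromy, Matrix.one_apply_ne hst.1])
    · exact absurd (by simp [listMonodromy, Matrix.one_apply_ne hi]) h
  | cons n l ih =>
    rw [List.pairwise_cons] at hl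
    have ih := ih hl.2
    have hn : ∀ m ∈ l, (m : ℕ) < n := fun m hm => hl.1 m hm
    have key : ∀ i, listMonodromy q η (n :: l) u i e s t ≠ 0 →
        ∃ j r, lax q n (u / η n) i j s r ≠ 0 ∧ listMonodromy q η l u j e r t ≠ 0 := by
      intro i h
      rw [listMonodromy_cons, Matrix.mul_apply, Matrix.sum_apply] at h
      obtain ⟨j, -, hj⟩ := Finset.exists_ne_zero_of_sum_ne_zero h
      rw [Matrix.mul_apply] at hj
      obtain ⟨r, -, hr⟩ := Finset.exists_ne_zero_of_sum_ne_zero hj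
      exact ⟨j, r, left_ne_zero_of_mul hr, right_ne_zero_of_mul hr⟩
    have hdiag : ∀ i r, lax q n (u / η n) i i s r ≠ 0 → s = r := by
      intro i r h
      by_contra hsr
      exact h (by rw [lax_diagonal, Matrix.diagonal_apply_ne _ hsr])
    refine ⟨fun h => ?_, fun i hi k hk h => ?_⟩
    · obtain ⟨j, r, h1, h2⟩ := key e h
      by_cases hj : j = e
      · subst hj
        rw [hdiag _ _ h1]
        exact (ih r).1 h2
      · obtain ⟨hs, hr, hm⟩ := lax_offDiagonal q n _ (Ne.symm hj) h1
        -- Leaving auxiliary state `e` at site `n` lowers the weight by exactly `n`; returning at a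
        -- later factor, at a site below `n`, raises it by less.
        have hw := weight_eq_add (e := e) hr (by rw [hs]; exact hj) fun m h => (hm m h).symm
        have := (ih r).2 j hj n hn h2
        right
        omega
    · obtain ⟨j, r, h1, h2⟩ := key i h
      have hnk := hk n List.mem_cons_self
      by_cases hj : j = e
      · subst hj
        obtain ⟨hs, hr, hm⟩ := lax_offDiagonal q n _ hi h1
        have hw := weight_eq_add (e := j) hs (by rw [hr]; exact hi) hm
        rcases (ih r).1 h2 with h | h
        · subst h; omega
        · omega
      · have hij : i = j := by
          fin_cases i <;> fin_cases j <;> fin_cases e <;> simp at hi hj ⊢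
        subst hij
        rw [hdiag _ _ h1]
        have := (ih r).2 i hj n hn h2
        omega

/-- A path that leaves auxiliary state `e` strictly changes the weight, so only the product of the
diagonal Lax entries contributes. -/
theorem listMonodromy_apply_self {N : ℕ} (q : ℂ) (η : Fin N → ℂ) (u : ℂ) (e : Fin 2)
    (l : List (Fin N)) (hl : l.Pairwise (· > ·)) (s : Config N) :
    listMonodromy q η l u e e s s = (l.map fun n => laxEigenvalue q e (s n) (u / η n)).prod := by
  induction l with
  | nil => simp [listMonodromy]
  | cons n l ih =>
    rw [List.pairwise_cons] at hl
    rw [listMonodromy_cons, Matrix.mul_apply, Matrix.sum_apply, Finset.sum_eq_single e,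
      lax_diagonal, Matrix.diagonal_mul, ih hl.2, List.map_cons, List.prod_cons]
    · intro j _ hj
      rw [Matrix.mul_apply]
      refine Finset.sum_eq_zero fun r _ => ?_
      by_contra hne
      obtain ⟨hs, hr, hm⟩ := lax_offDiagonal q n _ (Ne.symm hj) (left_ne_zero_of_mul hne)
      have hw := weight_eq_add (e := e) hr (by rw [hs]; exact hj) fun m h => (hm m h).symm
      have := (listMonodromy_triangular q η u e l hl.2 r s).2 j hj n (fun m hm => hl.1 m hm)
        (right_ne_zero_of_mul hne)
      omega
    · simp

theorem monodromy_apply_self {N : ℕ} (q : ℂ) (η : Fin N → ℂ) (u : ℂ) (e : Fin 2)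
    (s : Config N) :
    monodromy q η u e e s s = ∏ n, laxEigenvalue q e (s n) (u / η n) := by
  rw [monodromy_eq_listMonodromy, listMonodromy_apply_self, List.map_reverse, List.prod_reverse,
    ← List.ofFn_eq_map, List.prod_ofFn]
  rw [List.pairwise_reverse]
  exact List.pairwise_lt_finRange N

/-! ### Separation of the eigenvalue functions. -/

/-- The Laurent polynomial `laxEigenvalue` times `u`, as a polynomial. -/
noncomputable def laxEigenvaluePoly (q : ℂ) (e x : Fin 2) (c : ℂ) : Polynomial ℂ :=
  if x = e then Polynomial.C (q / c) * Polynomial.X ^ 2 - Polynomial.C (c / q)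
  else Polynomial.C c⁻¹ * Polynomial.X ^ 2 - Polynomial.C c

theorem eval_laxEigenvaluePoly (q : ℂ) (e x : Fin 2) {c u : ℂ} (hq : q ≠ 0) (hc : c ≠ 0)
    (hu : u ≠ 0) : (laxEigenvaluePoly q e x c).eval u = u * laxEigenvalue q e x (u / c) := by
  unfold laxEigenvaluePoly laxEigenvalue
  split_ifs <;> simp <;> field_simp

/-- The hypothesis on the inhomogeneities, in terms of squares. -/
theorem sq_ne_of_inhomogeneities {N : ℕ} {q : ℂ} (hq0 : q ≠ 0) {η : Fin N → ℂ}
    (hη : ∀ a b : Fin N, a < b → ∀ j : ℤ, j ∈ ({-1, 0, 1} : Set ℤ) →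
      η a ≠ q ^ j * η b ∧ η a ≠ -(q ^ j * η b)) {a b : Fin N} (hab : a ≠ b) :
    η a ^ 2 ≠ η b ^ 2 ∧ (q * η a) ^ 2 ≠ η b ^ 2 := by
  simp only [ne_eq, sq_eq_sq_iff_eq_or_eq_neg, not_or]
  rcases lt_or_gt_of_ne hab with h | h
  -- The hypothesis concerns ordered pairs only: `j = -1` gives the shifted condition when `a < b`,
  -- and `j = 1` gives it when `b < a`.
  · have h0 := hη a b h 0 (by simp)
    have h1 := hη a b h (-1) (by simp)
    simp only [zpow_zero, one_mul, zpow_neg, zpow_one] at h0 h1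
    refine ⟨h0, fun h => h1.1 ?_, fun h => h1.2 ?_⟩
    · rw [← h]; field_simp
    · rw [← mul_neg, ← h]; field_simp
  · have h0 := hη b a h 0 (by simp)
    have h1 := hη b a h 1 (by simp)
    simp only [zpow_zero, one_mul, zpow_one] at h0 h1
    refine ⟨⟨fun h => h0.1 h.symm, fun h => h0.2 ?_⟩, fun h => h1.1 h.symm, fun h => h1.2 ?_⟩
    · rw [h, neg_neg]
    · rw [h, neg_neg]

theorem laxEigenvalue_eq_zero_iff {q : ℂ} (hq0 : q ≠ 0) (e x : Fin 2) {u : ℂ} (hu : u ≠ 0) :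
    laxEigenvalue q e x u = 0 ↔ if x = e then (q * u) ^ 2 = 1 else u ^ 2 = 1 := by
  have h : ∀ w : ℂ, w ≠ 0 → (w - w⁻¹ = 0 ↔ w ^ 2 = 1) := by
    intro w hw
    rw [sub_eq_zero, ← mul_left_inj' hw, inv_mul_cancel₀ hw, sq]
  unfold laxEigenvalue
  split_ifs
  · exact h _ (mul_ne_zero hq0 hu)
  · exact h _ hu

/-- At `u = η n` the factor of site `n` is zero for `h` and `q - q⁻¹ ≠ 0` for `k`; the other factors
for `k` are nonzero by the condition on the inhomogeneities. -/
theorem prod_laxEigenvalue_ne {N : ℕ} {q : ℂ} (hq0 : q ≠ 0) (hq : q ^ 2 ≠ 1) {η : Fin N → ℂ}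
    (hη0 : ∀ n, η n ≠ 0)
    (hη : ∀ a b : Fin N, a < b → ∀ j : ℤ, j ∈ ({-1, 0, 1} : Set ℤ) →
      η a ≠ q ^ j * η b ∧ η a ≠ -(q ^ j * η b)) (e : Fin 2) {h k : Config N} {n : Fin N}
    (hh : h n ≠ e) (hk : k n = e) :
    ∏ m, laxEigenvalue q e (h m) (η n / η m) ≠ ∏ m, laxEigenvalue q e (k m) (η n / η m) := by
  rw [Finset.prod_eq_zero (Finset.mem_univ n)]
  · refine Ne.symm (Finset.prod_ne_zero_iff.2 fun m _ hm => ?_)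
    rw [laxEigenvalue_eq_zero_iff hq0 _ _ (div_ne_zero (hη0 n) (hη0 m))] at hm
    by_cases hmn : n = m
    · subst hmn
      rw [if_pos hk, div_self (hη0 n), mul_one] at hm
      exact hq hm
    · obtain ⟨h1, h2⟩ := sq_ne_of_inhomogeneities hq0 hη hmn
      have hm0 := pow_ne_zero 2 (hη0 m)
      split_ifs at hm
      · rw [← mul_div_assoc, div_pow, div_eq_one_iff_eq hm0] at hm
        exact h2 hm
      · rw [div_pow, div_eq_one_iff_eq hm0] at hm
        exact h1 hm
  · rw [laxEigenvalue_eq_zero_iff hq0 _ _ (div_ne_zero (hη0 n) (hη0 n)), if_neg hh,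
      div_self (hη0 n), one_pow]

/-- The eigenvalue functions of two spin configurations coincide at finitely many points. -/
theorem finite_eigenvalue_eq {N : ℕ} {q : ℂ} (hq0 : q ≠ 0) (hq : q ^ 2 ≠ 1) {η : Fin N → ℂ}
    (hη0 : ∀ n, η n ≠ 0)
    (hη : ∀ a b : Fin N, a < b → ∀ j : ℤ, j ∈ ({-1, 0, 1} : Set ℤ) →
      η a ≠ q ^ j * η b ∧ η a ≠ -(q ^ j * η b)) (e : Fin 2) {h k : Config N} (hhk : h ≠ k) :
    {u : ℂ | u ≠ 0 ∧ ∏ n, laxEigenvalue q e (h n) (u / η n) =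
      ∏ n, laxEigenvalue q e (k n) (u / η n)}.Finite := by
  -- The factor `u ^ N` clears the poles, so coincidences are roots of a polynomial that does not
  -- vanish at some `η n`.
  set P : Config N → Polynomial ℂ := fun s => ∏ n, laxEigenvaluePoly q e (s n) (η n)
  have heval : ∀ s u, u ≠ 0 →
      (P s).eval u = u ^ N * ∏ n, laxEigenvalue q e (s n) (u / η n) := by
    intro s u hu
    simp only [P, Polynomial.eval_prod, eval_laxEigenvaluePoly q e _ hq0 (hη0 _) hu,
      Finset.prod_mul_distrib, Finset.prod_const, Finset.card_univ, Fintype.card_fin]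
  obtain ⟨n, hn⟩ := Function.ne_iff.1 hhk
  have hne : ∏ m, laxEigenvalue q e (h m) (η n / η m) ≠
      ∏ m, laxEigenvalue q e (k m) (η n / η m) := by
    by_cases hk : k n = e
    · exact prod_laxEigenvalue_ne hq0 hq hη0 hη e (fun hh => hn (hh.trans hk.symm)) hk
    · refine (prod_laxEigenvalue_ne hq0 hq hη0 hη e hk ?_).symm
      generalize h n = x, k n = y at *
      fin_cases x <;> fin_cases y <;> fin_cases e <;> simp at hn hk ⊢
  have hP : P h - P k ≠ 0 := by
    intro h0
    have := congrArg (Polynomial.eval (η n)) h0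
    rw [Polynomial.eval_sub, heval _ _ (hη0 n), heval _ _ (hη0 n), Polynomial.eval_zero,
      ← mul_sub] at this
    exact mul_ne_zero (pow_ne_zero _ (hη0 n)) (sub_ne_zero.2 hne) this
  refine (Polynomial.finite_setOfPred_isRoot hP).subset fun u hu => ?_
  change (P h - P k).eval u = 0
  rw [Polynomial.eval_sub, heval _ _ hu.1, heval _ _ hu.1, hu.2, sub_self]

theorem exists_isSOVBasis_monodromy {N : ℕ} {q : ℂ} (hq0 : q ≠ 0) (hq : q ^ 2 ≠ 1)
    {η : Fin N → ℂ} (hη0 : ∀ n, η n ≠ 0)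
    (hη : ∀ a b : Fin N, a < b → ∀ j : ℤ, j ∈ ({-1, 0, 1} : Set ℤ) →
      η a ≠ q ^ j * η b ∧ η a ≠ -(q ^ j * η b)) (e : Fin 2) :
    ∃ b, IsSOVBasis (fun u => monodromy q η u e e) b := by
  have hfin : ∀ h k : Config N, h ≠ k →
      {u : ℂ | u ≠ 0 ∧ monodromy q η u e e h h = monodromy q η u e e k k}.Finite := by
    intro h k hhk
    simp only [monodromy_apply_self]
    exact finite_eigenvalue_eq hq0 hq hη0 hη e hhk
  obtain ⟨b, hb⟩ := exists_common_eigenbasis (weight e) (fun u => monodromy q η u e e)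
    (fun u s t hst h => by
      rw [monodromy_eq_listMonodromy] at h
      exact ((listMonodromy_triangular q η u e _
        (List.pairwise_reverse.2 (List.pairwise_lt_finRange N)) s t).1 h).resolve_left hst)
    (fun u v hu hv => by
      simp only [monodromy_eq_listMonodromy]
      exact listMonodromy_diagonal_commute q hq0 η hη0 _
        (List.nodup_reverse.2 (List.nodup_finRange N)) e u v hu hv) hfin
  exact ⟨b, fun h u => monodromy q η u e e h h, hb, hfin⟩

end SixVertex

theorem mainTheorem8 (N : ℕ) (q : ℂ) (hq0 : q ≠ 0) (hq : q ^ 2 ≠ 1)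
    (η : Fin N → ℂ) (hη0 : ∀ n, η n ≠ 0)
    (hη : ∀ a b : Fin N, a < b → ∀ j : ℤ, j ∈ ({-1, 0, 1} : Set ℤ) →
      η a ≠ q ^ j * η b ∧ η a ≠ -(q ^ j * η b)) :
    (∃ b, SixVertex.IsSOVBasis (SixVertex.opD q η) b) ∧
      (∃ b, SixVertex.IsSOVBasis (SixVertex.opA q η) b) :=
  ⟨SixVertex.exists_isSOVBasis_monodromy hq0 hq hη0 hη 1,
    SixVertex.exists_isSOVBasis_monodromy hq0 hq hη0 hη 0⟩
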